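/- For $n \in \mathbb{N}$, positive integers $k_1 \le \dots \le k_n$, ${\bf k} := (k_1,\dots,k_n)$ and $1 \le r \le n$, let $\mathcal{L}_{{\bf k},r}$ be the family of all sets $\{(x,y_x) : x \in X\}$ where $X$ is an $r$-element subset of $\{1,\dots,n\}$ and $y_x \in \{1,\dots,k_x\}$ for each $x \in X$. For a finite family $\mathcal{F}$ of finite sets and a set $S$, let $\mathcal{F}(S) := \{F \in \mathcal{F} : S \subseteq F\}$. A $t$-star of $\mathcal{F}$ is a family $\mathcal{F}(T)$ where $T$ is a $t$-element subset of some member of $\mathcal{F}$. A non-empty family $\mathcal{A}$ is $t$-intersecting if $|A \cap B| \ge t$ for all $A, B \in \mathcal{A}$ (including $A = B$). A $t$-intersecting sub-family of $\mathcal{F}$ is largest if no $t$-intersecting sub-family of $\mathcal{F}$ has more members. $\mathcal{F}$ has the $t$-star property at a $t$-element set $T$ if $\mathcal{F}(T)$ is a largest $t$-intersecting sub-family of $\mathcal{F}$. $\mathcal{F}$ has the strict $t$-star property if either $\mathcal{F}$ has no $t$-intersecting sub-family or every largest $t$-intersecting sub-family of $\mathcal{F}$ is a $t$-star of $\mathcal{F}$.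 Theorem. Let $1 \le t \le r$ and let $n \ge (r-t)\binom{3r-2t-1}{t+1} + r$. Let $1 \le k_1 \le \dots \le k_n$ be integers and let ${\bf k} := (k_1,\dots,k_n)$. Then: (i) $\mathcal{L}_{{\bf k},r}$ has the $t$-star property at $\{(1,1),\dots,(t,1)\}$; (ii) $\mathcal{L}_{{\bf k},r}$ has the strict $t$-star property. -/

import Mathlib

namespace LabeledSets

section Families

variable {α : Type*} [DecidableEq α]

/-- `𝓕(S)`: the members of the family `𝓕` that contain `S`. -/
def starOf (F : Finset (Finset α)) (S : Finset α) : Finset (Finset α) :=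
  F.filter (fun A => S ⊆ A)

/-- `𝓐` is a `t`-star of `𝓕`: `𝓐 = 𝓕(T)` for some `t`-element subset `T` of a member of `𝓕`. -/
def IsTStar (F : Finset (Finset α)) (t : ℕ) (A : Finset (Finset α)) : Prop :=
  ∃ T : Finset α, T.card = t ∧ (∃ B ∈ F, T ⊆ B) ∧ A = starOf F T

/-- `𝓐` is `t`-intersecting: any two (not necessarily distinct) members share at least `t`
elements. The empty family is not counted, so that a family has no `t`-intersecting
sub-families exactly when all its members have fewer than `t` elements. -/
def IsTIntersecting (t : ℕ) (A : Finset (Finset α)) : Prop :=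
  A.Nonempty ∧ ∀ B ∈ A, ∀ C ∈ A, t ≤ (B ∩ C).card

/-- `𝓐` is a largest `t`-intersecting sub-family of `𝓕`. -/
def IsLargestTIntersecting (F : Finset (Finset α)) (t : ℕ) (A : Finset (Finset α)) : Prop :=
  (A ⊆ F ∧ IsTIntersecting t A) ∧
    ∀ B : Finset (Finset α), B ⊆ F → IsTIntersecting t B → B.card ≤ A.card

/-- `𝓕` has the `t`-star property at `T`. -/
def HasTStarPropertyAt (F : Finset (Finset α)) (t : ℕ) (T : Finset α) : Prop :=
  T.card = t ∧ IsLargestTIntersecting F t (starOf F T)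

/-- `𝓕` has the strict `t`-star property. -/
def HasStrictTStarProperty (F : Finset (Finset α)) (t : ℕ) : Prop :=
  (¬ ∃ A : Finset (Finset α), A ⊆ F ∧ IsTIntersecting t A) ∨
    ∀ A : Finset (Finset α), IsLargestTIntersecting F t A → IsTStar F t A

end Families

/-- The family `𝓛_{k,r}` of labeled `r`-sets for `k = (k 1, …, k n)`: all sets
`{(x, y x) : x ∈ X}` with `X` an `r`-element subset of `{1, …, n}` and `y x ∈ {1, …, k x}` for
each `x ∈ X`. Values of `k` outside `{1, …, n}` play no role. -/
def labeledSets (n : ℕ) (k : ℕ → ℕ) (r : ℕ) : Finset (Finset (ℕ × ℕ)) :=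
  ((Finset.Icc 1 n).powersetCard r).biUnion fun X =>
    (X.pi fun x => Finset.Icc 1 (k x)).image fun y =>
      X.attach.image fun x => (x.1, y x.1 x.2)

theorem mem_labeledSets {n : ℕ} {k : ℕ → ℕ} {r : ℕ} {A : Finset (ℕ × ℕ)} :
    A ∈ labeledSets n k r ↔ ∃ X : Finset ℕ, X ⊆ Finset.Icc 1 n ∧ X.card = r ∧
      ∃ y : ℕ → ℕ, (∀ x ∈ X, y x ∈ Finset.Icc 1 (k x)) ∧ A = X.image fun x => (x, y x) := by
  simp only [labeledSets, Finset.mem_biUnion, Finset.mem_powersetCard, Finset.mem_image,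
    Finset.mem_pi]
  constructor
  · rintro ⟨X, ⟨hX, hr⟩, y, hy, rfl⟩
    refine ⟨X, hX, hr, fun x => if h : x ∈ X then y x h else 0, ?_, ?_⟩
    · intro x hx
      simpa [hx] using hy x hx
    · ext p
      simp only [Finset.mem_image, Finset.mem_attach, true_and, Subtype.exists]
      constructor
      · rintro ⟨x, hx, rfl⟩
        exact ⟨x, hx, by simp [hx]⟩
      · rintro ⟨x, hx, rfl⟩
        exact ⟨x, hx, by simp [hx]⟩
  · rintro ⟨X, hX, hr, y, hy, rfl⟩
    refine ⟨X, ⟨hX, hr⟩, fun x _ => y x, hy, ?_⟩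
    ext p
    simp

end LabeledSets

namespace LabeledSets

open Finset

/-! ### Kernels of `t`-intersecting families of `r`-sets -/

section Families

variable {α : Type*} [DecidableEq α]

/-! Suppose first that the members of a `t`-intersecting family share a `t`-set. The family then
lies in a `t`-star, and moving positions to larger values of `k` injects that star into the one at
`{(1,1), …, (t,1)}` (`card_starOf_le`). Otherwise some `J` with at most `3r - 2t - 1` elements meets
every member in at least `t + 1` points (`exists_kernel`), so the stars of the `(t + 1)`-subsets of
`J` cover the family. By double counting (`mul_card_starOf_le`), each has at most `(r - t) / (n - r
+ 1)` times the size of the best `t`-star. The bound on `n` makes the sum strictly smaller than that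
star, which gives both the maximum and the strict property. -/

theorem mem_starOf {F : Finset (Finset α)} {S A : Finset α} :
    A ∈ starOf F S ↔ A ∈ F ∧ S ⊆ A := by
  simp [starOf]

/-- If `A` and `B` meet in exactly a `t`-set that `C` does not contain, and `C` shares at least `t`
elements with each, then `C` has more than `t` elements in `A ∪ B`. -/
theorem succ_le_card_inter_union {t : ℕ} {A B C : Finset α} (hAB : (A ∩ B).card = t)
    (hC : ¬ A ∩ B ⊆ C) (hA : t ≤ (C ∩ A).card) (hB : t ≤ (C ∩ B).card) :
    t + 1 ≤ (C ∩ (A ∪ B)).card := by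
  have h1 := card_union_add_card_inter (C ∩ A) (C ∩ B)
  rw [← inter_union_distrib_left] at h1
  have h2 : ((C ∩ A) ∩ (C ∩ B)).card < (A ∩ B).card := by
    apply card_lt_card
    refine ⟨fun x hx => by simp only [mem_inter] at hx ⊢; tauto, fun h => hC fun x hx => ?_⟩
    exact (mem_inter.1 (mem_inter.1 (h hx)).1).1
  omega

/-- A `t`-intersecting family of `r`-sets whose members have no common `t`-subset has a set of size
at most `3r - 2t - 1` meeting every member in at least `t + 1` elements. -/
theorem exists_kernel {t r : ℕ} {𝒜 : Finset (Finset α)} (h𝒜 : IsTIntersecting t 𝒜)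
    (hr : ∀ A ∈ 𝒜, A.card = r) (hT : ∀ T : Finset α, T.card = t → ∃ A ∈ 𝒜, ¬ T ⊆ A) :
    ∃ J : Finset α, J.card ≤ 3 * r - 2 * t - 1 ∧ ∀ A ∈ 𝒜, t + 1 ≤ (A ∩ J).card := by
  obtain ⟨⟨A₀, hA₀⟩, hint⟩ := h𝒜
  -- If all intersections exceed `t`, any single member serves as `J`: then `t < r`, so `r ≤ 3r - 2t
  -- - 1`.
  by_cases hbig : ∀ A ∈ 𝒜, ∀ B ∈ 𝒜, t + 1 ≤ (A ∩ B).card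
  · refine ⟨A₀, ?_, fun A hA => hbig A hA A₀ hA₀⟩
    have h1 := hbig A₀ hA₀ A₀ hA₀
    rw [inter_self, hr A₀ hA₀] at h1
    rw [hr A₀ hA₀]
    omega
  push Not at hbig
  obtain ⟨A, hA, B, hB, hlt⟩ := hbig
  have hAB : (A ∩ B).card = t := le_antisymm (by omega) (hint A hA B hB)
  obtain ⟨C, hC, hTC⟩ := hT _ hAB
  have hCAB := succ_le_card_inter_union hAB hTC (hint C hC A hA) (hint C hC B hB)
  -- `A ∪ B` has `2r - t` elements, and `C` adds at most `r - (t + 1)` more.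
  refine ⟨(A ∪ B) ∪ C, ?_, fun D hD => ?_⟩
  · have h1 := card_union_add_card_inter A B
    have h2 := card_union_add_card_inter (A ∪ B) C
    have h3 := card_le_card (inter_subset_left (s₁ := C) (s₂ := A ∪ B))
    rw [inter_comm] at hCAB
    rw [hr A hA, hr B hB] at h1
    rw [hr C hC] at h2 h3
    omega
  -- If `D` contains `A ∩ B`, it contains a point of `A ∩ B` outside `C`, in addition to at least
  -- `t` points of `C`.
  by_cases hTD : A ∩ B ⊆ D
  · have h1 : ((D ∩ C) ∩ (A ∩ B)).card < (A ∩ B).card := by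
      apply card_lt_card
      refine ⟨inter_subset_right, fun h => hTC fun x hx => ?_⟩
      exact (mem_inter.1 (mem_inter.1 (h hx)).1).2
    have h2 := card_union_add_card_inter (D ∩ C) (A ∩ B)
    have h3 : (D ∩ C) ∪ (A ∩ B) ⊆ D ∩ (A ∪ B ∪ C) := by
      intro x hx
      have := @hTD x
      simp only [mem_union, mem_inter] at *
      tauto
    have h4 := card_le_card h3
    have h5 := hint D hD C hC
    omega
  · exact (succ_le_card_inter_union hAB hTD (hint D hD A hA) (hint D hD B hB)).trans
      (card_le_card (inter_subset_inter_left subset_union_left))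

/-- A subfamily whose members all meet `J` in at least `m` elements is covered by the stars of the
`m`-subsets of `J`. -/
theorem card_le_choose_mul {F 𝒜 : Finset (Finset α)} {J : Finset α} {m a b : ℕ} (h𝒜 : 𝒜 ⊆ F)
    (hJ : ∀ A ∈ 𝒜, m ≤ (A ∩ J).card)
    (hb : ∀ S : Finset α, S.card = m → a * (starOf F S).card ≤ b) :
    a * 𝒜.card ≤ J.card.choose m * b := by
  have hsub : 𝒜 ⊆ (J.powersetCard m).biUnion (starOf F) := by
    intro A hA
    obtain ⟨S, hS, hSm⟩ := exists_subset_card_eq (hJ A hA)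
    rw [mem_biUnion]
    exact ⟨S, mem_powersetCard.2 ⟨hS.trans inter_subset_right, hSm⟩,
      mem_starOf.2 ⟨h𝒜 hA, hS.trans inter_subset_left⟩⟩
  calc a * 𝒜.card ≤ a * ∑ S ∈ J.powersetCard m, (starOf F S).card :=
        Nat.mul_le_mul_left _ ((card_le_card hsub).trans card_biUnion_le)
    _ = ∑ S ∈ J.powersetCard m, a * (starOf F S).card := mul_sum _ _ _
    _ ≤ ∑ _S ∈ J.powersetCard m, b :=
        sum_le_sum fun S hS => hb S (mem_powersetCard.1 hS).2
    _ = J.card.choose m * b := by rw [sum_const, card_powersetCard, smul_eq_mul]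

end Families

/-! ### Exchanges in labeled sets and double counting -/

variable {n r t : ℕ} {k : ℕ → ℕ}

/-- Eliminates `X` and `y` in favour of conditions on the points of `A`, which suit exchanges of
single points. -/
theorem mem_labeledSets_iff {A : Finset (ℕ × ℕ)} :
    A ∈ labeledSets n k r ↔ A.card = r ∧
      (∀ p ∈ A, p.1 ∈ Icc 1 n ∧ p.2 ∈ Icc 1 (k p.1)) ∧ Set.InjOn Prod.fst (A : Set (ℕ × ℕ)) := by
  rw [mem_labeledSets]
  constructor
  · rintro ⟨X, hX, rfl, y, hy, rfl⟩
    refine ⟨card_image_of_injective _ fun a b h => (Prod.mk.inj h).1, ?_, ?_⟩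
    · intro p hp
      obtain ⟨x, hx, rfl⟩ := mem_image.1 hp
      exact ⟨hX hx, hy x hx⟩
    · intro p hp q hq hpq
      obtain ⟨x, hx, rfl⟩ := mem_image.1 (mem_coe.1 hp)
      obtain ⟨x', hx', rfl⟩ := mem_image.1 (mem_coe.1 hq)
      cases hpq
      rfl
  · rintro ⟨hc, hmem, hinj⟩
    have hex : ∀ x, ∃ y, x ∈ A.image Prod.fst → (x, y) ∈ A := by
      intro x
      by_cases hx : x ∈ A.image Prod.fst
      · obtain ⟨⟨_, y⟩, hp, rfl⟩ := mem_image.1 hx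
        exact ⟨y, fun _ => hp⟩
      · exact ⟨0, fun h => absurd h hx⟩
    choose y hy using hex
    refine ⟨A.image Prod.fst, ?_, by rw [card_image_of_injOn hinj, hc], y,
      fun x hx => (hmem _ (hy x hx)).2, ?_⟩
    · intro x hx
      exact (hmem _ (hy x hx)).1
    · ext p
      constructor
      · intro hp
        have hx := mem_image_of_mem Prod.fst hp
        exact mem_image.2 ⟨p.1, hx, hinj (mem_coe.2 (hy _ hx)) (mem_coe.2 hp) rfl⟩
      · intro hp
        obtain ⟨x, hx, rfl⟩ := mem_image.1 hp
        exact hy x hx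

/-- Replacing an element of a labeled set by an element over an unused position. -/
theorem insert_erase_mem_labeledSets {A : Finset (ℕ × ℕ)} {p q : ℕ × ℕ}
    (hA : A ∈ labeledSets n k r) (hp : p ∈ A) (hq1 : q.1 ∈ Icc 1 n) (hq2 : q.2 ∈ Icc 1 (k q.1))
    (hq : q.1 ∉ (A.erase p).image Prod.fst) : insert q (A.erase p) ∈ labeledSets n k r := by
  obtain ⟨hc, hmem, hinj⟩ := mem_labeledSets_iff.1 hA
  have hqA : q ∉ A.erase p := fun h => hq (mem_image_of_mem _ h)
  refine mem_labeledSets_iff.2 ⟨?_, ?_, ?_⟩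
  · rw [card_insert_of_notMem hqA, card_erase_add_one hp, hc]
  · intro a ha
    rcases mem_insert.1 ha with rfl | ha
    · exact ⟨hq1, hq2⟩
    · exact hmem a (mem_of_mem_erase ha)
  · rw [coe_insert, Set.injOn_insert (mem_coe.not.2 hqA)]
    refine ⟨hinj.mono (coe_subset.2 (erase_subset p A)), ?_⟩
    rwa [← coe_image, mem_coe]

/-- Double counting: adjoining an element to `S` shrinks its star by a factor of order `n`. -/
theorem mul_card_starOf_le (hk : ∀ i ∈ Set.Icc 1 n, 1 ≤ k i) (hrn : r ≤ n)
    {S : Finset (ℕ × ℕ)} (hS : S.card = t + 1) {p : ℕ × ℕ} (hp : p ∈ S) :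
    (n - r + 1) * (starOf (labeledSets n k r) S).card ≤
      (r - t) * (starOf (labeledSets n k r) (S.erase p)).card := by
  rw [mul_comm, mul_comm (r - t)]
  -- Relate `A ⊇ S` to `B ⊇ S.erase p` when `B` arises from `A` by replacing `p` (possibly by
  -- itself).
  refine card_mul_le_card_mul (fun A B : Finset (ℕ × ℕ) => A.erase p ⊆ B) ?_ ?_
  · intro A hA
    obtain ⟨hAL, hSA⟩ := mem_starOf.1 hA
    obtain ⟨hc, hmem, hinj⟩ := mem_labeledSets_iff.1 hAL
    have hpA := hSA hp
    set U := Icc 1 n \ A.image Prod.fst with hU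
    have hUc : U.card = n - r := by
      rw [hU, card_sdiff_of_subset, Nat.card_Icc, card_image_of_injOn hinj, hc]
      · omega
      · intro x hx
        obtain ⟨a, ha, rfl⟩ := mem_image.1 hx
        exact (hmem a ha).1
    -- Replacements for `p`: `p` itself, which gives the `+ 1`, and the label 1, always allowed,
    -- over each of the `n - r` unused positions.
    set V := insert p (U.image fun x => (x, 1)) with hV
    have hpU : p ∉ U.image fun x => (x, 1) := by
      intro h
      obtain ⟨x, hx, rfl⟩ := mem_image.1 h
      exact (mem_sdiff.1 hx).2 (mem_image_of_mem Prod.fst hpA)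
    have hVc : V.card = n - r + 1 := by
      rw [hV, card_insert_of_notMem hpU,
        card_image_of_injective _ fun a b h => (Prod.mk.inj h).1, hUc]
    have hVA : ∀ q ∈ V, q ∉ A.erase p := by
      intro q hq hqA
      rcases mem_insert.1 hq with rfl | hq
      · exact (mem_erase.1 hqA).1 rfl
      · obtain ⟨x, hx, rfl⟩ := mem_image.1 hq
        exact (mem_sdiff.1 hx).2 (mem_image_of_mem Prod.fst (mem_of_mem_erase hqA))
    rw [← hVc]
    refine card_le_card_of_injOn (fun q => insert q (A.erase p)) ?_ ?_
    · intro q hq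
      rw [mem_coe, mem_bipartiteAbove, mem_starOf]
      refine ⟨⟨?_, (erase_subset_erase p hSA).trans (subset_insert _ _)⟩, subset_insert _ _⟩
      rcases mem_insert.1 (mem_coe.1 hq) with rfl | hq
      · simpa only [insert_erase hpA] using hAL
      · obtain ⟨x, hx, rfl⟩ := mem_image.1 hq
        obtain ⟨hxn, hxA⟩ := mem_sdiff.1 hx
        have := hk x (by simpa using hxn)
        exact insert_erase_mem_labeledSets hAL hpA hxn (by simpa using this)
          fun h => hxA (image_subset_image (erase_subset _ _) h)
    · intro q hq q' _ h
      have h' : insert q (A.erase p) = insert q' (A.erase p) := h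
      have : q ∈ insert q' (A.erase p) := h' ▸ mem_insert_self _ _
      exact (mem_insert.1 this).resolve_right (hVA q hq)
  · intro B hB
    obtain ⟨hBL, hSB⟩ := mem_starOf.1 hB
    obtain ⟨hc, -, -⟩ := mem_labeledSets_iff.1 hBL
    have hcard : (B \ S.erase p).card = r - t := by
      rw [card_sdiff_of_subset hSB, card_erase_of_mem hp, hS, hc, Nat.add_sub_cancel]
    rw [← hcard]
    -- `A` is recovered from `B` by exchanging for `p` one of the `r - t` points of `B` outside
    -- `S.erase p`.
    refine (card_le_card ?_).trans
      (card_image_le (s := B \ S.erase p) (f := fun q => insert p (B.erase q)))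
    intro A hA
    obtain ⟨hA, hAB⟩ := (mem_bipartiteBelow _).1 hA
    obtain ⟨hAL, hSA⟩ := mem_starOf.1 hA
    have hAc := (mem_labeledSets_iff.1 hAL).1
    have hpA := hSA hp
    have hlt : (A.erase p).card + 1 = B.card := by rw [card_erase_add_one hpA, hAc, hc]
    obtain ⟨q, hq⟩ := card_eq_one.1 (show (B \ A.erase p).card = 1 by
      rw [card_sdiff_of_subset hAB]; omega)
    have hqB : q ∈ B \ A.erase p := hq ▸ mem_singleton_self q
    refine mem_image.2 ⟨q, ?_, ?_⟩
    · exact mem_sdiff.2 ⟨(mem_sdiff.1 hqB).1,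
        fun h => (mem_sdiff.1 hqB).2 (erase_subset_erase p hSA h)⟩
    · have : B.erase q = A.erase p := by
        rw [← sdiff_singleton_eq_erase, ← hq, Finset.sdiff_sdiff_eq_self hAB]
      simp only [this, insert_erase hpA]

/-! ### Comparison of `t`-stars -/

/-- Positions outside a `t`-set `X` embed into positions beyond `t` without decreasing `k`. -/
theorem exists_shift {X : Finset ℕ} (hX : X ⊆ Icc 1 n) (hXt : X.card = t)
    (hk : MonotoneOn k (Set.Icc 1 n)) :
    ∃ f : ℕ → ℕ, Set.InjOn f {x | x ∉ X} ∧
      ∀ x ∈ Icc 1 n, x ∉ X → f x ∈ Icc 1 n ∧ f x ∉ Icc 1 t ∧ k x ≤ k (f x) := by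
  have hcard : (Icc 1 t \ X).card = (X \ Icc 1 t).card := by
    have h1 := card_sdiff_add_card_inter (Icc 1 t) X
    have h2 := card_sdiff_add_card_inter X (Icc 1 t)
    rw [inter_comm] at h2
    rw [Nat.card_Icc] at h1
    omega
  let e := equivOfCardEq hcard
  have he : ∀ x, (e x).1 ∈ X ∧ (e x).1 ∉ Icc 1 t := fun x => mem_sdiff.1 (e x).2
  -- Only positions in `Icc 1 t` outside `X` move, and they go to positions of `X` beyond `t`. Hence
  -- `k` does not decrease, and no collision occurs with the fixed positions outside `X`.
  refine ⟨fun x => if h : x ∈ Icc 1 t \ X then e ⟨x, h⟩ else x, ?_, ?_⟩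
  · intro x hx y hy hxy
    simp only at hxy
    split_ifs at hxy with h1 h2 h2
    · simpa using e.injective (Subtype.ext hxy)
    · exact absurd (hxy ▸ (he ⟨x, h1⟩).1) hy
    · exact absurd (hxy ▸ (he ⟨y, h2⟩).1) hx
    · exact hxy
  · intro x hxn hxX
    simp only
    split_ifs with h
    · obtain ⟨h1, h2⟩ := he ⟨x, h⟩
      have h3 := hX h1
      refine ⟨h3, h2, hk (by simpa using hxn) (by simpa using h3) ?_⟩
      have h4 := (mem_sdiff.1 h).1
      simp only [mem_Icc] at h2 h3 h4
      omega
    · exact ⟨hxn, fun h' => h (mem_sdiff.2 ⟨h', hxX⟩), le_rfl⟩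

/-- The `t`-element set `{(1, 1), …, (t, 1)}`. -/
def initialSet (t : ℕ) : Finset (ℕ × ℕ) := (Icc 1 t).image fun i => (i, 1)

theorem mem_initialSet {p : ℕ × ℕ} : p ∈ initialSet t ↔ p.1 ∈ Icc 1 t ∧ p.2 = 1 := by
  obtain ⟨a, b⟩ := p
  simp only [initialSet, mem_image, Prod.mk.injEq]
  constructor
  · rintro ⟨i, hi, rfl, rfl⟩
    exact ⟨hi, rfl⟩
  · rintro ⟨h, rfl⟩
    exact ⟨a, h, rfl, rfl⟩

theorem card_initialSet : (initialSet t).card = t := by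
  rw [initialSet, card_image_of_injective _ fun a b h => (Prod.mk.inj h).1, Nat.card_Icc,
    Nat.add_sub_cancel]

theorem injOn_fst_initialSet : Set.InjOn Prod.fst (initialSet t : Set (ℕ × ℕ)) := by
  intro p hp q hq h
  exact Prod.ext h ((mem_initialSet.1 hp).2.trans (mem_initialSet.1 hq).2.symm)

theorem initialSet_mem_labeledSets (hk : ∀ i ∈ Set.Icc 1 n, 1 ≤ k i) (hrn : r ≤ n) :
    initialSet r ∈ labeledSets n k r := by
  refine mem_labeledSets_iff.2 ⟨card_initialSet, fun p hp => ?_, injOn_fst_initialSet⟩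
  obtain ⟨h1, h2⟩ := mem_initialSet.1 hp
  rw [mem_Icc] at h1
  have h3 : p.1 ∈ Icc 1 n := mem_Icc.2 ⟨h1.1, h1.2.trans hrn⟩
  exact ⟨h3, by rw [h2]; exact mem_Icc.2 ⟨le_rfl, hk _ (by simpa using h3)⟩⟩

theorem initialSet_mono (htr : t ≤ r) : initialSet t ⊆ initialSet r :=
  image_subset_image (Icc_subset_Icc_right htr)

/-- Among the `t`-stars of the labeled sets, the one at `{(1, 1), …, (t, 1)}` is largest. -/
theorem card_starOf_le (hk : ∀ i ∈ Set.Icc 1 n, 1 ≤ k i) (hmono : MonotoneOn k (Set.Icc 1 n))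
    (htn : t ≤ n) {T : Finset (ℕ × ℕ)} (hT : T.card = t) {B : Finset (ℕ × ℕ)}
    (hB : B ∈ labeledSets n k r) (hTB : T ⊆ B) :
    (starOf (labeledSets n k r) T).card ≤ (starOf (labeledSets n k r) (initialSet t)).card := by
  obtain ⟨-, hBmem, hBinj⟩ := mem_labeledSets_iff.1 hB
  obtain ⟨f, hf, hfk⟩ := exists_shift (X := T.image Prod.fst) (t := t) (n := n) (k := k)
    (by
      intro x hx
      obtain ⟨p, hp, rfl⟩ := mem_image.1 hx
      exact (hBmem p (hTB hp)).1)
    (by rw [card_image_of_injOn (hBinj.mono (coe_subset.2 hTB)), hT]) hmono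
  let g : ℕ × ℕ → ℕ × ℕ := Prod.map f id
  have hg : Set.InjOn g {p | p.1 ∉ T.image Prod.fst} := by
    intro p hp q hq h
    exact Prod.ext (hf hp hq (congrArg Prod.fst h)) (show (g p).2 = (g q).2 from congrArg Prod.snd h)
  have hfree : ∀ A ∈ starOf (labeledSets n k r) T, ∀ p ∈ A \ T, p.1 ∉ T.image Prod.fst := by
    intro A hA p hp hpT
    obtain ⟨hAL, hTA⟩ := mem_starOf.1 hA
    obtain ⟨q, hq, hqp⟩ := mem_image.1 hpT
    obtain ⟨hpA, hpnT⟩ := mem_sdiff.1 hp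
    exact hpnT ((mem_labeledSets_iff.1 hAL).2.2 (hTA hq) hpA hqp ▸ hq)
  have hprop : ∀ A ∈ starOf (labeledSets n k r) T, ∀ p ∈ A \ T,
      f p.1 ∈ Icc 1 n ∧ f p.1 ∉ Icc 1 t ∧ p.2 ∈ Icc 1 (k (f p.1)) := by
    intro A hA p hp
    obtain ⟨h1, h2⟩ :=
      (mem_labeledSets_iff.1 (mem_starOf.1 hA).1).2.1 p (mem_sdiff.1 hp).1
    obtain ⟨h3, h4, h5⟩ := hfk p.1 h1 (hfree A hA p hp)
    exact ⟨h3, h4, Icc_subset_Icc_right h5 h2⟩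
  have hdisj : ∀ A ∈ starOf (labeledSets n k r) T,
      Disjoint (initialSet t) ((A \ T).image g) := by
    intro A hA
    rw [disjoint_right]
    intro p hp hpt
    obtain ⟨q, hq, rfl⟩ := mem_image.1 hp
    exact (hprop A hA q hq).2.1 (mem_initialSet.1 hpt).1
  -- Swap `T` for the initial set and shift the remaining positions, keeping labels; disjointness of
  -- the two pieces makes this reversible.
  refine card_le_card_of_injOn (fun A => initialSet t ∪ (A \ T).image g) ?_ ?_
  · intro A hA
    obtain ⟨hAL, hTA⟩ := mem_starOf.1 (mem_coe.1 hA)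
    obtain ⟨hc, -, hinj⟩ := mem_labeledSets_iff.1 hAL
    refine mem_coe.2 (mem_starOf.2 ⟨mem_labeledSets_iff.2 ⟨?_, ?_, ?_⟩, subset_union_left⟩)
    · rw [card_union_of_disjoint (hdisj A hA), card_initialSet,
        card_image_of_injOn (hg.mono fun p hp => hfree A hA p hp), card_sdiff_of_subset hTA,
        hT, hc]
      have := card_le_card hTA
      omega
    · intro p hp
      rcases mem_union.1 hp with hp | hp
      · exact (mem_labeledSets_iff.1 (initialSet_mem_labeledSets hk htn)).2.1 p hp
      · obtain ⟨q, hq, rfl⟩ := mem_image.1 hp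
        obtain ⟨h1, -, h2⟩ := hprop A hA q hq
        exact ⟨h1, h2⟩
    · rw [coe_union, Set.injOn_union (disjoint_coe.2 (hdisj A hA))]
      refine ⟨injOn_fst_initialSet, ?_, ?_⟩
      · intro p hp p' hp' h
        obtain ⟨q, hq, rfl⟩ := mem_image.1 (mem_coe.1 hp)
        obtain ⟨q', hq', rfl⟩ := mem_image.1 (mem_coe.1 hp')
        have := hf (hfree A hA q hq) (hfree A hA q' hq') h
        rw [hinj (mem_sdiff.1 hq).1 (mem_sdiff.1 hq').1 this]
      · intro p hp p' hp' h
        obtain ⟨q', hq', rfl⟩ := mem_image.1 (mem_coe.1 hp')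
        have h1 := (mem_initialSet.1 (mem_coe.1 hp)).1
        rw [h] at h1
        exact (hprop A hA q' hq').2.1 h1
  · intro A hA A' hA' h
    have h' : (A \ T).image g = (A' \ T).image g := by
      have h0 : initialSet t ∪ (A \ T).image g = initialSet t ∪ (A' \ T).image g := h
      rw [← union_sdiff_cancel_left (hdisj A hA), h0, union_sdiff_cancel_left (hdisj A' hA')]
    have h'' : A \ T = A' \ T := by
      apply coe_injective
      refine (hg.image_eq_image_iff (fun p hp => hfree A hA p hp)
        (fun p hp => hfree A' hA' p hp)).1 ?_
      simpa only [coe_image] using congrArg (fun s : Finset (ℕ × ℕ) => (s : Set (ℕ × ℕ))) h'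
    rw [← sdiff_union_of_subset (mem_starOf.1 hA).2, h'',
      sdiff_union_of_subset (mem_starOf.1 hA').2]

theorem card_starOf_initialSet_pos (hk : ∀ i ∈ Set.Icc 1 n, 1 ≤ k i) (htr : t ≤ r)
    (hrn : r ≤ n) : 0 < (starOf (labeledSets n k r) (initialSet t)).card :=
  card_pos.2 ⟨_, mem_starOf.2 ⟨initialSet_mem_labeledSets hk hrn, initialSet_mono htr⟩⟩

/-! ### Bound for nontrivial families and conclusion -/

/-- A `t`-intersecting family of labeled sets that is not contained in a `t`-star is smaller than
the star at `{(1, 1), …, (t, 1)}`. -/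
theorem card_lt_of_nontrivial (hk : ∀ i ∈ Set.Icc 1 n, 1 ≤ k i)
    (hmono : MonotoneOn k (Set.Icc 1 n)) (htr : t ≤ r)
    (hn : (r - t) * (3 * r - 2 * t - 1).choose (t + 1) + r ≤ n)
    {𝒜 : Finset (Finset (ℕ × ℕ))} (hsub : 𝒜 ⊆ labeledSets n k r) (h𝒜 : IsTIntersecting t 𝒜)
    (hT : ∀ T : Finset (ℕ × ℕ), T.card = t → ∃ A ∈ 𝒜, ¬ T ⊆ A) :
    𝒜.card < (starOf (labeledSets n k r) (initialSet t)).card := by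
  have hrn : r ≤ n := le_of_add_le_right hn
  have hpos := card_starOf_initialSet_pos (t := t) hk htr hrn
  set L := (starOf (labeledSets n k r) (initialSet t)).card with hL
  obtain ⟨J, hJ, hJ𝒜⟩ :=
    exists_kernel h𝒜 (fun A hA => (mem_labeledSets_iff.1 (hsub hA)).1) hT
  have hS : ∀ S : Finset (ℕ × ℕ), S.card = t + 1 →
      (n - r + 1) * (starOf (labeledSets n k r) S).card ≤ (r - t) * L := by
    intro S hSc
    -- A nonempty star supplies the member containing `S.erase p` that `card_starOf_le` requires.
    rcases (starOf (labeledSets n k r) S).eq_empty_or_nonempty with h0 | ⟨B, hB⟩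
    · simp [h0]
    obtain ⟨p, hp⟩ : S.Nonempty := card_pos.1 (by omega)
    obtain ⟨hBL, hSB⟩ := mem_starOf.1 hB
    exact (mul_card_starOf_le hk hrn hSc hp).trans (Nat.mul_le_mul_left _
      (card_starOf_le hk hmono (htr.trans hrn) (by rw [card_erase_of_mem hp, hSc]; rfl) hBL
        ((erase_subset _ _).trans hSB)))
  have h1 := card_le_choose_mul hsub hJ𝒜 hS
  -- Strictness comes from the `+ 1` in `n - r + 1`, together with `L > 0`.
  have h2 : J.card.choose (t + 1) * ((r - t) * L) < (n - r + 1) * L := by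
    calc J.card.choose (t + 1) * ((r - t) * L)
        ≤ (3 * r - 2 * t - 1).choose (t + 1) * ((r - t) * L) :=
          Nat.mul_le_mul_right _ (Nat.choose_le_choose _ hJ)
      _ = (r - t) * (3 * r - 2 * t - 1).choose (t + 1) * L := by ring
      _ < (n - r + 1) * L := Nat.mul_lt_mul_of_pos_right (by omega) hpos
  exact lt_of_mul_lt_mul_left (h1.trans_lt h2) (Nat.zero_le _)

end LabeledSets

open LabeledSets in
theorem mainTheorem2 (t r n : ℕ) (ht : 1 ≤ t) (htr : t ≤ r)
    (hn : (r - t) * Nat.choose (3 * r - 2 * t - 1) (t + 1) + r ≤ n)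
    (k : ℕ → ℕ) (hk_pos : ∀ i ∈ Set.Icc 1 n, 1 ≤ k i) (hk_mono : MonotoneOn k (Set.Icc 1 n)) :
    LabeledSets.HasTStarPropertyAt (LabeledSets.labeledSets n k r) t
        ((Finset.Icc 1 t).image fun i => (i, 1)) ∧
      LabeledSets.HasStrictTStarProperty (LabeledSets.labeledSets n k r) t := by
  have hrn : r ≤ n := le_of_add_le_right hn
  have hstar : ∀ {𝒜 : Finset (Finset (ℕ × ℕ))} {T : Finset (ℕ × ℕ)}, 𝒜 ⊆ labeledSets n k r →
      IsTIntersecting t 𝒜 → T.card = t → (∀ A ∈ 𝒜, T ⊆ A) →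
      𝒜 ⊆ starOf (labeledSets n k r) T ∧ (∃ B ∈ labeledSets n k r, T ⊆ B) ∧
        (starOf (labeledSets n k r) T).card ≤
          (starOf (labeledSets n k r) (initialSet t)).card := by
    intro 𝒜 T hsub h𝒜 hT hall
    obtain ⟨B, hB⟩ := h𝒜.1
    exact ⟨fun A hA => mem_starOf.2 ⟨hsub hA, hall A hA⟩, ⟨B, hsub hB, hall B hB⟩,
      card_starOf_le hk_pos hk_mono (htr.trans hrn) hT (hsub hB) (hall B hB)⟩
  have hlargest : IsLargestTIntersecting (labeledSets n k r) t
      (starOf (labeledSets n k r) (initialSet t)) := by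
    refine ⟨⟨Finset.filter_subset _ _,
      Finset.card_pos.1 (card_starOf_initialSet_pos hk_pos htr hrn), ?_⟩, ?_⟩
    · intro B hB C hC
      rw [← card_initialSet (t := t)]
      exact Finset.card_le_card
        (Finset.subset_inter (mem_starOf.1 hB).2 (mem_starOf.1 hC).2)
    · intro 𝒜 hsub h𝒜
      by_cases hT : ∀ T : Finset (ℕ × ℕ), T.card = t → ∃ A ∈ 𝒜, ¬ T ⊆ A
      · exact (card_lt_of_nontrivial hk_pos hk_mono htr hn hsub h𝒜 hT).le
      · push Not at hT
        obtain ⟨T, hTc, hall⟩ := hT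
        obtain ⟨h1, -, h2⟩ := hstar hsub h𝒜 hTc hall
        exact (Finset.card_le_card h1).trans h2
  refine ⟨⟨card_initialSet, hlargest⟩, Or.inr fun 𝒜 h𝒜 => ?_⟩
  obtain ⟨⟨hsub, hint⟩, hmax⟩ := h𝒜
  have hle := hmax _ hlargest.1.1 hlargest.1.2
  by_cases hT : ∀ T : Finset (ℕ × ℕ), T.card = t → ∃ A ∈ 𝒜, ¬ T ⊆ A
  · exact absurd (card_lt_of_nontrivial hk_pos hk_mono htr hn hsub hint hT) hle.not_gt
  · push Not at hT
    obtain ⟨T, hTc, hall⟩ := hT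
    obtain ⟨h1, h2, h3⟩ := hstar hsub hint hTc hall
    -- The star at `T` contains `𝒜` and is no larger than it, so the two coincide.
    exact ⟨T, hTc, h2, Finset.eq_of_subset_of_card_le h1 (h3.trans hle)⟩
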